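/- Consider the $M/M/2$ queue with strategic servers: customers arrive as a Poisson process of rate $\lambda>0$, wait in FIFO order when both servers are busy, and have independent service requirements, exponential with mean one at unit service rate; server $i\in\{1,2\}$ chooses a service rate $\mu_i>\lambda/2$. Under the $r$-routing policy ($r\in\mathbb{R}$), the next customer is sent to server $i$ in the set $\mathcal I$ of idle servers with probability $\mu_i^r/\sum_{j\in\mathcal I}\mu_j^r$; $r=0$ is the policy Random. Server $i$ has utility $U_i(\mu_1,\mu_2)=I_i(\mu_1,\mu_2)-c(\mu_i)$, where $I_i(\mu_1,\mu_2)$ is the steady-state probability that server $i$ is idle. The common effort cost $c$ is a (strictly) increasing, convex, three times differentiable function on $(0,\infty)$ with $c'''\ge 0$ and $c'(\lambda/2)<1/\lambda$. A rate $\mu^\star>\lambda/2$ is a symmetric equilibrium if $(\mu^\star,\mu^\star)$ is a Nash equilibrium, that is, $U_i(\mu^\star,\mu^\star)$ is the maximum of the utility of server $i$ over all rates $\mu_i>\lambda/2$ when the other server works at rate $\mu^\star$ ($i=1,2$). Then, for all $r\in\mathbb{R}$ and $\mu_1,\mu_2>\lambda/2$, the queue has a unique steady-state distribution (so the game is well defined),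 and for every $r\in\{-2,-1,0,1\}$ there is exactly one symmetric equilibrium under the $r$-routing policy. Moreover, the steady-state mean response time (waiting plus service) at the symmetric equilibrium is finite for $r=-2$ and for $r=0$, and it is strictly smaller for $r=-2$ than for $r=0$. -/

import Mathlib

open Set

noncomputable section

namespace MM2

/-- States of the two-server queue: nobody is present; exactly one customer is present, in service
at server `i` (the other server is idle); both servers are busy and `k` customers wait in line. -/
inductive State : Type
  | empty : State
  | single (i : Fin 2) : State
  | busy (k : ℕ) : State

/-- Under the `r`-routing policy, the probability that the next customer is sent to server `i`
when `idle` is the set of idle servers and `μ` is the vector of service rates. -/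
def routingProb (r : ℝ) (μ : Fin 2 → ℝ) (idle : Finset (Fin 2)) (i : Fin 2) : ℝ :=
  μ i ^ r / ∑ j ∈ idle, μ j ^ r

/-- Transition rates (between distinct states) of the Markov chain of the queue with Poisson
arrivals at rate `lam`, exponential services at rates `μ 0`, `μ 1`, first-in-first-out order and
`r`-routing. The server other than `i` is `Fin.rev i`. A customer who finds exactly one
idle server goes to that server. -/
def rate (lam r : ℝ) (μ : Fin 2 → ℝ) : State → State → ℝ
  | .empty, .single i => lam * routingProb r μ Finset.univ i
  | .single i, .empty => μ i
  | .single _, .busy 0 => lam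
  | .busy 0, .single i => μ (Fin.rev i)
  | .busy k, .busy l => if l = k + 1 then lam else if k = l + 1 then μ 0 + μ 1 else 0
  | _, _ => 0

/-- `π` is a steady-state distribution of the chain: a probability distribution on the states
that satisfies the global balance equations (flow into `s` equals flow out of `s`). All the flow
sums have only finitely many nonzero terms. -/
structure IsSteadyState (lam r : ℝ) (μ : Fin 2 → ℝ) (π : State → ℝ) : Prop where
  nonneg : ∀ s, 0 ≤ π s
  hasSum_one : HasSum π 1
  balance : ∀ s, ∑' t, π t * rate lam r μ t s = π s * ∑' t, rate lam r μ s t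

open Classical in
/-- The steady-state distribution (the zero function if there is none). -/
def steadyState (lam r : ℝ) (μ : Fin 2 → ℝ) : State → ℝ :=
  if h : ∃ π, IsSteadyState lam r μ π then h.choose else 0

/-- Server `i` is idle in the given state. -/
def IsIdle (i : Fin 2) : State → Prop
  | .empty => True
  | .single j => j ≠ i
  | .busy _ => False

/-- The steady-state probability that server `i` is idle. -/
def idleProb (lam r : ℝ) (μ : Fin 2 → ℝ) (i : Fin 2) : ℝ :=
  ∑' s, {s | IsIdle i s}.indicator (steadyState lam r μ) s

/-- The utility of server `i`: steady-state idleness minus the cost of effort. -/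
def utility (lam r : ℝ) (c : ℝ → ℝ) (μ : Fin 2 → ℝ) (i : Fin 2) : ℝ :=
  idleProb lam r μ i - c (μ i)

/-- Nash equilibria of the game in which every server chooses a rate in `(lam / 2, ∞)`. -/
def IsNashEquilibrium (lam r : ℝ) (c : ℝ → ℝ) (μ : Fin 2 → ℝ) : Prop :=
  (∀ i, lam / 2 < μ i) ∧
    ∀ i, ∀ x, lam / 2 < x → utility lam r c (Function.update μ i x) i ≤ utility lam r c μ i

/-- `m` is a symmetric equilibrium service rate. -/
def IsSymmetricEquilibrium (lam r : ℝ) (c : ℝ → ℝ) (m : ℝ) : Prop :=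
  IsNashEquilibrium lam r c fun _ => m

/-- Effort cost functions on the positive rates: increasing, convex, three times differentiable,
with nonnegative third derivative. -/
structure IsEffortCost (c : ℝ → ℝ) : Prop where
  strictMonoOn : StrictMonoOn c (Ioi 0)
  convexOn : ConvexOn ℝ (Ioi 0) c
  differentiableAt : ∀ k < 3, ∀ x > 0, DifferentiableAt ℝ (iteratedDeriv k c) x
  third_nonneg : ∀ x > 0, 0 ≤ iteratedDeriv 3 c x

/-- Mean response time (waiting plus service) of a customer who on arrival finds the given state.
A customer who finds both servers busy and `k` customers waiting needs `k + 1` departures, at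
total rate `μ 0 + μ 1`, before service starts; the last of them is at server `i`, who then serves
the customer, with probability `μ i / (μ 0 + μ 1)`. -/
def meanResponseFrom (r : ℝ) (μ : Fin 2 → ℝ) : State → ℝ
  | .empty => ∑ i, routingProb r μ Finset.univ i * (1 / μ i)
  | .single i => 1 / μ (Fin.rev i)
  | .busy k => (k + 1) / (μ 0 + μ 1) + ∑ i, μ i / (μ 0 + μ 1) * (1 / μ i)

/-- `T` is the (finite) mean response time of a customer who arrives to the queue in steady
state. -/
def HasMeanResponseTime (lam r : ℝ) (μ : Fin 2 → ℝ) (T : ℝ) : Prop :=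
  HasSum (fun s => steadyState lam r μ s * meanResponseFrom r μ s) T

end MM2

end

/-! The balance equations can be solved by hand: cut equations make the busy states geometric, and a
nonsingular 2x2 system fixes the two single-customer states (`Balanced.eq_weight`). This gives the
unique steady state and a rational formula `idleFun` for the idle probability, in which `r` enters
only through the routing probability.

The heart is `idleFun_expansion`: for the four values of `r`, with the opponent at rate `m`, the
idle probability lies below its tangent at `m` on all of `x > lam / 2`, although no concavity is
established. Since a convex cost lies above its tangent, the first-order condition `deriv c m =
marginalIdle lam r m` is both necessary and sufficient for equilibrium
(`isSymmetricEquilibrium_iff`).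

The left side of this equation is positive and nondecreasing in `m`; the right side strictly
decreases from `1 / lam` at `lam / 2` and is at most `2 / m`. So there is exactly one solution. For
fixed `m > lam / 2` the right side decreases in `r`, so the equilibrium rate is larger for `r = -2`
than for `r = 0`. At equal rates the mean response time does not depend on `r` and strictly
decreases in the common rate. -/

namespace MM2

/-! ### Flow sums and balance equations -/

theorem State.busy_injective : Function.Injective State.busy := fun _ _ h => State.busy.inj h

/-- Summation over the states: the three states with an idle server, and the busy states. -/
theorem hasSum_state {f : State → ℝ} {B : ℝ} (h : HasSum (fun k => f (.busy k)) B) :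
    HasSum f (f .empty + f (.single 0) + f (.single 1) + B) := by
  classical
  have h1 := (State.busy_injective.hasSum_range_iff (f := fun s => f s)).2 h
  have h2 := Finset.hasSum ({.empty, .single 0, .single 1} : Finset State) f
  have hc : IsCompl (↑({.empty, .single 0, .single 1} : Finset State) : Set State)
      (Set.range State.busy) := by
    rw [← eq_compl_iff_isCompl]
    ext s
    cases s with
    | empty => simp
    | single i => fin_cases i <;> simp
    | busy k => simp
  have h3 := HasSum.add_isCompl (f := f) hc h2 h1
  simpa [add_assoc] using h3

/-- The balance equations with all flow sums evaluated. -/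
structure Balanced (lam : ℝ) (p μ : Fin 2 → ℝ) (π : State → ℝ) : Prop where
  empty : μ 0 * π (.single 0) + μ 1 * π (.single 1) = lam * π .empty
  single : ∀ i, π .empty * (lam * p i) + π (.busy 0) * μ (Fin.rev i)
    = π (.single i) * (μ i + lam)
  busy_zero : lam * (π (.single 0) + π (.single 1)) + (μ 0 + μ 1) * π (.busy 1)
    = π (.busy 0) * (lam + (μ 0 + μ 1))
  busy_succ : ∀ k, lam * π (.busy k) + (μ 0 + μ 1) * π (.busy (k + 2))
    = π (.busy (k + 1)) * (lam + (μ 0 + μ 1))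

section Flow

variable (lam r : ℝ) (μ : Fin 2 → ℝ) (π : State → ℝ)

theorem outflow_empty :
    ∑' t, rate lam r μ .empty t
      = lam * (routingProb r μ Finset.univ 0 + routingProb r μ Finset.univ 1) := by
  have := (hasSum_state (f := rate lam r μ .empty) (B := 0) (by simp [rate, hasSum_zero])).tsum_eq
  rw [this]; simp [rate]; ring

theorem outflow_single (i : Fin 2) : ∑' t, rate lam r μ (.single i) t = μ i + lam := by
  have hb : HasSum (fun k => rate lam r μ (.single i) (.busy k)) lam := by
    convert hasSum_ite_eq (0 : ℕ) lam using 2 with k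
    cases k <;> simp [rate]
  rw [(hasSum_state hb).tsum_eq]; simp [rate]

theorem outflow_busy_zero :
    ∑' t, rate lam r μ (.busy 0) t = lam + (μ 0 + μ 1) := by
  have hb : HasSum (fun k => rate lam r μ (.busy 0) (.busy k)) lam := by
    convert hasSum_ite_eq (1 : ℕ) lam using 2 with k
    simp [rate]
  rw [(hasSum_state hb).tsum_eq]; simp [rate, Fin.rev]; ring

theorem outflow_busy_succ (k : ℕ) :
    ∑' t, rate lam r μ (.busy (k + 1)) t = lam + (μ 0 + μ 1) := by
  have hb : HasSum (fun l => rate lam r μ (.busy (k + 1)) (.busy l)) (lam + (μ 0 + μ 1)) := by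
    convert (hasSum_ite_eq (k + 2) lam).add (hasSum_ite_eq k (μ 0 + μ 1)) using 2 with l
    simp only [rate]
    split_ifs <;> first | omega | simp
  rw [(hasSum_state hb).tsum_eq]; simp [rate]

theorem inflow_empty :
    ∑' t, π t * rate lam r μ t .empty = μ 0 * π (.single 0) + μ 1 * π (.single 1) := by
  have hb : HasSum (fun k => π (.busy k) * rate lam r μ (.busy k) .empty) 0 := by
    simp [rate, hasSum_zero]
  rw [(hasSum_state (f := fun t => π t * rate lam r μ t .empty) hb).tsum_eq]; simp [rate]; ring

theorem inflow_single (i : Fin 2) :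
    ∑' t, π t * rate lam r μ t (.single i)
      = π .empty * (lam * routingProb r μ Finset.univ i) + π (.busy 0) * μ (Fin.rev i) := by
  have hb : HasSum (fun k => π (.busy k) * rate lam r μ (.busy k) (.single i))
      (π (.busy 0) * μ (Fin.rev i)) := by
    convert hasSum_ite_eq (0 : ℕ) (π (.busy 0) * μ (Fin.rev i)) using 2 with k
    cases k <;> simp [rate]
  rw [(hasSum_state (f := fun t => π t * rate lam r μ t (.single i)) hb).tsum_eq]; simp [rate]

theorem inflow_busy_zero :
    ∑' t, π t * rate lam r μ t (.busy 0)
      = lam * (π (.single 0) + π (.single 1)) + (μ 0 + μ 1) * π (.busy 1) := by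
  have hb : HasSum (fun k => π (.busy k) * rate lam r μ (.busy k) (.busy 0))
      ((μ 0 + μ 1) * π (.busy 1)) := by
    convert hasSum_ite_eq (1 : ℕ) ((μ 0 + μ 1) * π (.busy 1)) using 2 with k
    by_cases h : k = 1 <;> simp [rate, h, mul_comm]
  rw [(hasSum_state (f := fun t => π t * rate lam r μ t (.busy 0)) hb).tsum_eq]
  simp [rate]; ring

theorem inflow_busy_succ (k : ℕ) :
    ∑' t, π t * rate lam r μ t (.busy (k + 1))
      = lam * π (.busy k) + (μ 0 + μ 1) * π (.busy (k + 2)) := by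
  have hb : HasSum (fun l => π (.busy l) * rate lam r μ (.busy l) (.busy (k + 1)))
      (lam * π (.busy k) + (μ 0 + μ 1) * π (.busy (k + 2))) := by
    convert (hasSum_ite_eq k (lam * π (.busy k))).add
      (hasSum_ite_eq (k + 2) ((μ 0 + μ 1) * π (.busy (k + 2)))) using 2 with l
    simp only [rate]
    split_ifs <;> first | omega | (subst_vars; simp [mul_comm])
  rw [(hasSum_state (f := fun t => π t * rate lam r μ t (.busy (k + 1))) hb).tsum_eq]
  simp [rate]

variable {lam r μ π}

theorem balance_iff
    (hp : routingProb r μ Finset.univ 0 + routingProb r μ Finset.univ 1 = 1) :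
    (∀ s, ∑' t, π t * rate lam r μ t s = π s * ∑' t, rate lam r μ s t) ↔
      Balanced lam (routingProb r μ Finset.univ) μ π := by
  constructor
  · intro h
    refine ⟨?_, fun i => ?_, ?_, fun k => ?_⟩
    · have := h .empty
      rw [inflow_empty, outflow_empty, hp] at this
      linarith
    · have := h (.single i)
      rwa [inflow_single, outflow_single] at this
    · have := h (.busy 0)
      rwa [inflow_busy_zero, outflow_busy_zero] at this
    · have := h (.busy (k + 1))
      rwa [inflow_busy_succ, outflow_busy_succ] at this
  · rintro ⟨h1, h2, h3, h4⟩ s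
    match s with
    | .empty => rw [inflow_empty, outflow_empty, hp, h1]; ring
    | .single i => rw [inflow_single, outflow_single, h2]
    | .busy 0 => rw [inflow_busy_zero, outflow_busy_zero, h3]
    | .busy (k + 1) => rw [inflow_busy_succ, outflow_busy_succ, h4]

end Flow

/-! ### Routing probabilities and the stationary distribution -/

section Routing

variable {r : ℝ} {μ : Fin 2 → ℝ}

theorem routingProb_pos (hμ : ∀ i, 0 < μ i) (i : Fin 2) :
    0 < routingProb r μ Finset.univ i := by
  have h := fun j => Real.rpow_pos_of_pos (hμ j) r
  exact div_pos (h i) (Finset.sum_pos (fun j _ => h j) Finset.univ_nonempty)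

theorem routingProb_add (hμ : ∀ i, 0 < μ i) (i : Fin 2) :
    routingProb r μ Finset.univ i + routingProb r μ Finset.univ (Fin.rev i) = 1 := by
  have h := fun j => Real.rpow_pos_of_pos (hμ j) r
  have h0 := h 0
  have h1 := h 1
  have : μ 0 ^ r + μ 1 ^ r ≠ 0 := by positivity
  fin_cases i <;> simp [routingProb, Fin.rev] <;> field_simp
  ring

end Routing

/-- The stationary measure that gives mass one to the empty state. -/
noncomputable def weight (lam : ℝ) (p μ : Fin 2 → ℝ) : State → ℝ
  | .empty => 1
  | .single i => lam * (lam + p i * (μ 0 + μ 1)) / (μ i * (μ 0 + μ 1 + 2 * lam))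
  | .busy k => lam / (μ 0 + μ 1) *
      (lam * (lam + p 0 * (μ 0 + μ 1)) / (μ 0 * (μ 0 + μ 1 + 2 * lam)) +
        lam * (lam + p 1 * (μ 0 + μ 1)) / (μ 1 * (μ 0 + μ 1 + 2 * lam))) *
      (lam / (μ 0 + μ 1)) ^ k

section Weight

variable {lam : ℝ} {p μ : Fin 2 → ℝ}

theorem weight_busy (k : ℕ) :
    weight lam p μ (.busy k) = lam / (μ 0 + μ 1) *
      (weight lam p μ (.single 0) + weight lam p μ (.single 1)) * (lam / (μ 0 + μ 1)) ^ k := rfl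

theorem weight_pos (hlam : 0 < lam) (hμ : ∀ i, 0 < μ i) (hp : ∀ i, 0 < p i) (s : State) :
    0 < weight lam p μ s := by
  have := hμ 0
  have := hμ 1
  have := hp 0
  have := hp 1
  cases s with
  | empty => simp [weight]
  | single i => have := hμ i; have := hp i; simp only [weight]; positivity
  | busy k => simp only [weight]; positivity

theorem weight_balanced (hlam : 0 < lam) (hμ : ∀ i, 0 < μ i) (hp : p 0 + p 1 = 1) :
    Balanced lam p μ (weight lam p μ) := by
  have h0 := hμ 0
  have h1 := hμ 1
  have hp1 : p 1 = 1 - p 0 := by linarith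
  refine ⟨?_, fun i => ?_, ?_, fun k => ?_⟩
  · simp only [weight]; rw [hp1]; field_simp; ring
  · fin_cases i <;> simp [weight, Fin.rev, hp1] <;> field_simp <;> ring
  · rw [weight_busy, weight_busy]; field_simp; ring
  · rw [weight_busy, weight_busy, weight_busy, pow_add _ k 2, pow_succ _ k]; field_simp; ring

/-- The deviations `d0`, `d1` of the single-customer masses from the multiple of `weight` solve a
homogeneous linear system, hence vanish; the cut equations then carry the identity along the busy
states. -/
theorem Balanced.eq_weight {π : State → ℝ} (h : Balanced lam p μ π) (hlam : 0 < lam)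
    (hμ : ∀ i, 0 < μ i) (hp : p 0 + p 1 = 1) (s : State) :
    π s = π .empty * weight lam p μ s := by
  have h0 := hμ 0
  have h1 := hμ 1
  have hM : 0 < μ 0 + μ 1 := by positivity
  have hw := weight_balanced hlam hμ hp
  have hs0 := h.single 0
  have hs1 := h.single 1
  have hv0 := hw.single 0
  have hv1 := hw.single 1
  rw [show Fin.rev (0 : Fin 2) = 1 from rfl] at hs0 hv0
  rw [show Fin.rev (1 : Fin 2) = 0 from rfl] at hs1 hv1
  have he := h.empty
  have hve := hw.empty
  have w0 : weight lam p μ .empty = 1 := rfl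
  rw [w0] at hv0 hv1 hve
  -- the flow through the cut between the busy and the other states
  have hb : (μ 0 + μ 1) * π (.busy 0) = lam * (π (.single 0) + π (.single 1)) := by
    linear_combination hs0 + hs1 + he - lam * π .empty * hp
  have hvb : (μ 0 + μ 1) * weight lam p μ (.busy 0)
      = lam * (weight lam p μ (.single 0) + weight lam p μ (.single 1)) := by
    linear_combination hv0 + hv1 + hve - lam * hp
  set d0 := π (.single 0) - π .empty * weight lam p μ (.single 0) with hd0
  set d1 := π (.single 1) - π .empty * weight lam p μ (.single 1) with hd1
  have e0 : d0 * ((μ 0 + lam) * (μ 0 + μ 1)) = lam * (d0 + d1) * μ 1 := by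
    linear_combination (exp := 1) -(μ 0 + μ 1) * hs0 + π .empty * (μ 0 + μ 1) * hv0
      + μ 1 * hb - π .empty * μ 1 * hvb
  have e1 : μ 0 * d0 + μ 1 * d1 = 0 := by
    linear_combination he - π .empty * hve
  have z0 : d0 = 0 := by
    -- Eliminating `d1` from `e0` and `e1` leaves a positive coefficient on `d0`.
    have : d0 * (μ 0 * μ 1 * (μ 0 + μ 1 + 2 * lam)) = 0 := by
      linear_combination μ 1 * e0 + lam * μ 1 * e1
    rcases mul_eq_zero.1 this with h | h
    · exact h
    · exact absurd h (by positivity)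
  have z1 : d1 = 0 := by
    rw [z0] at e1
    simpa [h1.ne'] using e1
  have t0 : π (.single 0) = π .empty * weight lam p μ (.single 0) := by linarith
  have t1 : π (.single 1) = π .empty * weight lam p μ (.single 1) := by linarith
  have tb : π (.busy 0) = π .empty * weight lam p μ (.busy 0) := by
    apply mul_left_cancel₀ hM.ne'
    rw [hb, t0, t1]
    linear_combination -π .empty * hvb
  -- Each balance equation of a busy state, added to the preceding cut equation, gives the next one.
  have cut : ∀ k, (μ 0 + μ 1) * π (.busy (k + 1)) = lam * π (.busy k) := by
    intro k
    induction k with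
    | zero => linear_combination h.busy_zero + hb
    | succ k ih => linear_combination h.busy_succ k + ih
  match s with
  | .empty => simp [w0]
  | .single 0 => exact t0
  | .single 1 => exact t1
  | .busy k =>
    induction k with
    | zero => exact tb
    | succ k ih =>
      apply mul_left_cancel₀ hM.ne'
      rw [cut, ih, weight_busy, weight_busy, pow_succ]
      field_simp

/-- The total mass of `weight`. -/
noncomputable def totalWeight (lam : ℝ) (p μ : Fin 2 → ℝ) : ℝ :=
  1 + (weight lam p μ (.single 0) + weight lam p μ (.single 1)) *
    ((μ 0 + μ 1) / (μ 0 + μ 1 - lam))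

/-- A geometric series of ratio `lam / (μ 0 + μ 1)`, which is below one because each rate exceeds
`lam / 2`. -/
theorem hasSum_weight (hlam : 0 < lam) (hμ : ∀ i, lam / 2 < μ i) :
    HasSum (weight lam p μ) (totalWeight lam p μ) := by
  have h0 := hμ 0
  have h1 := hμ 1
  have hM : lam < μ 0 + μ 1 := by linarith
  have hM0 : 0 < μ 0 + μ 1 := by linarith
  have hlt : lam / (μ 0 + μ 1) < 1 := (div_lt_one hM0).2 hM
  have hb := (hasSum_geometric_of_lt_one (by positivity) hlt).mul_left (lam / (μ 0 + μ 1) *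
      (weight lam p μ (.single 0) + weight lam p μ (.single 1)))
  convert hasSum_state (f := weight lam p μ) hb using 1
  rw [totalWeight]
  generalize weight lam p μ (.single 0) = a
  generalize weight lam p μ (.single 1) = b
  have : μ 0 + μ 1 - lam ≠ 0 := by linarith
  have h3 : 1 - lam / (μ 0 + μ 1) = (μ 0 + μ 1 - lam) / (μ 0 + μ 1) := by field_simp
  rw [h3]
  simp only [weight]
  field_simp
  ring

theorem totalWeight_pos (hlam : 0 < lam) (hμ : ∀ i, lam / 2 < μ i) (hp : ∀ i, 0 < p i) :
    0 < totalWeight lam p μ := by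
  have hμ' : ∀ i, 0 < μ i := fun i => by linarith [hμ i]
  have h0 := hμ 0
  have h1 := hμ 1
  have hM : 0 < μ 0 + μ 1 - lam := by linarith
  have hM0 : 0 < μ 0 + μ 1 := by linarith
  have := weight_pos hlam hμ' hp (.single 0)
  have := weight_pos hlam hμ' hp (.single 1)
  rw [totalWeight]
  positivity

end Weight

section SteadyState

variable {lam r : ℝ} {μ : Fin 2 → ℝ}

theorem isSteadyState_iff (hlam : 0 < lam) (hμ : ∀ i, lam / 2 < μ i) (π : State → ℝ) :
    IsSteadyState lam r μ π ↔ π = fun s => weight lam (routingProb r μ Finset.univ) μ s /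
      totalWeight lam (routingProb r μ Finset.univ) μ := by
  have hμ' : ∀ i, 0 < μ i := fun i => by linarith [hμ i]
  have hp := routingProb_add (r := r) hμ' 0
  have hpos := routingProb_pos (r := r) hμ'
  have hZ := totalWeight_pos hlam hμ hpos
  have hsum := hasSum_weight (p := routingProb r μ Finset.univ) hlam hμ
  constructor
  · rintro ⟨-, h1, h2⟩
    have he := ((balance_iff hp).1 h2).eq_weight hlam hμ' hp
    have : HasSum π (π .empty * totalWeight lam (routingProb r μ Finset.univ) μ) := by
      simpa only [← he] using hsum.mul_left (π .empty)
    have hone := h1.unique this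
    funext s
    rw [he s, eq_div_iff hZ.ne', mul_right_comm, ← hone, one_mul]
  · rintro rfl
    refine ⟨fun _ => (div_pos (weight_pos hlam hμ' hpos _) hZ).le, ?_, ?_⟩
    · simpa [hZ.ne'] using hsum.div_const (totalWeight lam (routingProb r μ Finset.univ) μ)
    · rw [balance_iff hp]
      have hw := weight_balanced hlam hμ' hp
      refine ⟨?_, fun i => ?_, ?_, fun k => ?_⟩
      · field_simp; linear_combination hw.empty
      · field_simp; linear_combination hw.single i
      · field_simp; linear_combination hw.busy_zero
      · field_simp; linear_combination hw.busy_succ k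

theorem existsUnique_isSteadyState (hlam : 0 < lam) (hμ : ∀ i, lam / 2 < μ i) :
    ∃! π, IsSteadyState lam r μ π := by
  simp only [isSteadyState_iff hlam hμ, existsUnique_eq]

theorem steadyState_eq (hlam : 0 < lam) (hμ : ∀ i, lam / 2 < μ i) :
    steadyState lam r μ = fun s => weight lam (routingProb r μ Finset.univ) μ s /
      totalWeight lam (routingProb r μ Finset.univ) μ := by
  have h := (existsUnique_isSteadyState (r := r) hlam hμ).exists
  rw [steadyState, dif_pos h]
  exact (isSteadyState_iff hlam hμ _).1 h.choose_spec

theorem idleProb_eq (hlam : 0 < lam) (hμ : ∀ i, lam / 2 < μ i) (i : Fin 2) :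
    idleProb lam r μ i =
      (1 + weight lam (routingProb r μ Finset.univ) μ (.single (Fin.rev i))) /
        totalWeight lam (routingProb r μ Finset.univ) μ := by
  have hb : HasSum (fun k => {s | IsIdle i s}.indicator (steadyState lam r μ) (.busy k)) 0 := by
    simp [IsIdle, hasSum_zero]
  rw [idleProb, (hasSum_state hb).tsum_eq, steadyState_eq hlam hμ]
  fin_cases i <;> simp [IsIdle, Set.indicator, Fin.rev, weight] <;> ring

end SteadyState

/-! ### Closed form and tangent expansion of the idle probability -/

/-- The idle probability of a server with rate `x` when the other one has rate `m` and a
customer who finds the queue empty goes to the former with probability `p`. -/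
noncomputable def idleFun (lam p x m : ℝ) : ℝ :=
  x * (x + m - lam) * (m * (x + m) + 2 * lam * m + lam ^ 2 + lam * (1 - p) * (x + m)) /
    (x * m * (x + m + 2 * lam) * (x + m - lam)
      + lam * (x + m) ^ 2 * (lam + p * m + (1 - p) * x))

theorem idleProb_eq_idleFun {lam r : ℝ} {μ : Fin 2 → ℝ} (hlam : 0 < lam)
    (hμ : ∀ i, lam / 2 < μ i) (i : Fin 2) :
    idleProb lam r μ i =
      idleFun lam (routingProb r μ Finset.univ i) (μ i) (μ (Fin.rev i)) := by
  have hμ' : ∀ i, 0 < μ i := fun i => by linarith [hμ i]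
  have hp := routingProb_add (r := r) hμ' i
  have hpos := routingProb_pos (r := r) hμ' i
  have hpos' := routingProb_pos (r := r) hμ' (Fin.rev i)
  have hZ := totalWeight_pos hlam hμ (routingProb_pos (r := r) hμ')
  have hx := hμ' i
  have hm := hμ' (Fin.rev i)
  have hM : 0 < μ i + μ (Fin.rev i) - lam := by linarith [hμ i, hμ (Fin.rev i)]
  have hZe : totalWeight lam (routingProb r μ Finset.univ) μ =
      1 + (weight lam (routingProb r μ Finset.univ) μ (.single i)
        + weight lam (routingProb r μ Finset.univ) μ (.single (Fin.rev i))) *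
        ((μ i + μ (Fin.rev i)) / (μ i + μ (Fin.rev i) - lam)) := by
    fin_cases i <;> simp [totalWeight, Fin.rev, add_comm]
  have hMe : μ 0 + μ 1 = μ i + μ (Fin.rev i) := by
    fin_cases i <;> simp [Fin.rev, add_comm]
  rw [idleProb_eq hlam hμ, idleFun, hZe]
  rw [hZe] at hZ
  simp only [weight, hMe] at hZ ⊢
  generalize routingProb r μ Finset.univ (Fin.rev i) = q at *
  generalize routingProb r μ Finset.univ i = p at *
  generalize μ (Fin.rev i) = m at *
  generalize μ i = x at *
  have hp1 : p = 1 - q := by linarith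
  have hD : 0 < x * m * (x + m + 2 * lam) * (x + m - lam)
      + lam * (x + m) ^ 2 * (lam + p * m + (1 - p) * x) := by
    rw [show 1 - p = q by linarith]; positivity
  rw [div_eq_div_iff hZ.ne' hD.ne']
  subst hp1
  field_simp
  ring

/-- The second-order remainder of the idle probability for `r = -2`, cleared of denominators. -/
def remainderNegTwo (h a b : ℝ) : ℝ :=
  (96 * h ^ 7 + 816 * h ^ 6 * b + 1520 * h ^ 5 * b ^ 2 +
      1360 * h ^ 4 * b ^ 3 + 664 * h ^ 3 * b ^ 4 + 168 * h ^ 2 * b ^ 5 +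
      16 * h * b ^ 6) +
  (720 * h ^ 6 + 2272 * h ^ 5 * b + 2488 * h ^ 4 * b ^ 2 +
      1304 * h ^ 3 * b ^ 3 + 344 * h ^ 2 * b ^ 4 + 40 * h * b ^ 5) * a +
  (912 * h ^ 5 + 1792 * h ^ 4 * b + 1264 * h ^ 3 * b ^ 2 +
      400 * h ^ 2 * b ^ 3 + 48 * h * b ^ 4) * a ^ 2 +
  (504 * h ^ 4 + 696 * h ^ 3 * b + 296 * h ^ 2 * b ^ 2 + 40 * h * b ^ 3) * a ^ 3 +
  (72 * h ^ 3 + 72 * h ^ 2 * b + 16 * h * b ^ 2) * a ^ 4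

/-- The variables stand for `lam / 2` and the excesses of the two rates over it. In these variables
every coefficient is positive, so the sign is immediate; the other three remainders work the same
way. -/
theorem remainderNegTwo_nonneg {h a b : ℝ} (hh : 0 ≤ h) (ha : 0 ≤ a) (hb : 0 ≤ b) :
    0 ≤ remainderNegTwo h a b := by
  unfold remainderNegTwo
  positivity

/-- The second-order remainder of the idle probability for `r = -1`, cleared of denominators. -/
def remainderNegOne (h a b : ℝ) : ℝ :=
  (192 * h ^ 6 + 816 * h ^ 5 * b + 1072 * h ^ 4 * b ^ 2 +
      620 * h ^ 3 * b ^ 3 + 164 * h ^ 2 * b ^ 4 + 16 * h * b ^ 5) +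
  (720 * h ^ 5 + 1464 * h ^ 4 * b + 1104 * h ^ 3 * b ^ 2 +
      364 * h ^ 2 * b ^ 3 + 44 * h * b ^ 4) * a +
  (456 * h ^ 4 + 588 * h ^ 3 * b + 260 * h ^ 2 * b ^ 2 + 40 * h * b ^ 3) * a ^ 2 +
  (72 * h ^ 3 + 60 * h ^ 2 * b + 12 * h * b ^ 2) * a ^ 3

theorem remainderNegOne_nonneg {h a b : ℝ} (hh : 0 ≤ h) (ha : 0 ≤ a) (hb : 0 ≤ b) :
    0 ≤ remainderNegOne h a b := by
  unfold remainderNegOne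
  positivity

/-- The second-order remainder of the idle probability for `r = 0`, cleared of denominators. -/
def remainderZero (h a b : ℝ) : ℝ :=
  (288 * h ^ 5 + 720 * h ^ 4 * b + 592 * h ^ 3 * b ^ 2 +
      176 * h ^ 2 * b ^ 3 + 16 * h * b ^ 4) +
  (624 * h ^ 4 + 688 * h ^ 3 * b + 256 * h ^ 2 * b ^ 2 + 32 * h * b ^ 3) * a +
  (96 * h ^ 3 + 80 * h ^ 2 * b + 16 * h * b ^ 2) * a ^ 2

theorem remainderZero_nonneg {h a b : ℝ} (hh : 0 ≤ h) (ha : 0 ≤ a) (hb : 0 ≤ b) :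
    0 ≤ remainderZero h a b := by
  unfold remainderZero
  positivity

/-- The second-order remainder of the idle probability for `r = 1`, cleared of denominators. -/
def remainderOne (h a b : ℝ) : ℝ :=
  (384 * h ^ 6 + 912 * h ^ 5 * b + 800 * h ^ 4 * b ^ 2 +
      292 * h ^ 3 * b ^ 3 + 36 * h ^ 2 * b ^ 4) +
  (816 * h ^ 5 + 1288 * h ^ 4 * b + 688 * h ^ 3 * b ^ 2 +
      124 * h ^ 2 * b ^ 3 + 4 * h * b ^ 4) * a +
  (360 * h ^ 4 + 388 * h ^ 3 * b + 116 * h ^ 2 * b ^ 2 + 8 * h * b ^ 3) * a ^ 2 +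
  (24 * h ^ 3 + 28 * h ^ 2 * b + 4 * h * b ^ 2) * a ^ 3

theorem remainderOne_nonneg {h a b : ℝ} (hh : 0 ≤ h) (ha : 0 ≤ a) (hb : 0 ≤ b) :
    0 ≤ remainderOne h a b := by
  unfold remainderOne
  positivity

/-- The derivative of the idle probability of a server in its own rate, when both servers have
rate `m`. -/
noncomputable def marginalIdle (lam r m : ℝ) : ℝ :=
  lam * ((4 - 2 * r) * m + (4 + r) * lam) / (4 * m * (m + lam) * (2 * m + lam))

/-- Second-order expansion of the idle probability, from an identity between polynomials. -/
theorem idleFun_expansion_of_identity {lam r m : ℝ} {w₁ w₂ q : ℝ → ℝ} (hlam : 0 < lam)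
    (hm : lam / 2 < m) (hw₁ : ∀ x > 0, 0 < w₁ x) (hw₂ : ∀ x > 0, 0 < w₂ x)
    (hw₁c : Continuous w₁) (hw₂c : Continuous w₂) (hqc : Continuous q)
    (hq : ∀ x, lam / 2 < x → 0 ≤ q x)
    (hp : ∀ x > 0, x ^ r / (x ^ r + m ^ r) = w₁ x / (w₁ x + w₂ x))
    (hid : ∀ x, ((w₁ x + w₂ x) * (x * m * (x + m + 2 * lam) * (x + m - lam)) +
        lam * (x + m) ^ 2 * (lam * (w₁ x + w₂ x) + w₁ x * m + w₂ x * x)) *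
        (2 * (2 * m - lam) * (m + lam) * (2 * m + lam) +
          lam * ((4 - 2 * r) * m + (4 + r) * lam) * (x - m)) -
        4 * m * (m + lam) * (2 * m + lam) * (x * (x + m - lam) *
          ((w₁ x + w₂ x) * (m * (x + m) + 2 * lam * m + lam ^ 2) + lam * w₂ x * (x + m))) =
        (x - m) ^ 2 * q x) :
    ∃ R : ℝ → ℝ, ContinuousAt R m ∧ ∀ x, lam / 2 < x → 0 ≤ R x ∧
      idleFun lam (x ^ r / (x ^ r + m ^ r)) x m =
        1 - lam / (2 * m) + marginalIdle lam r m * (x - m) - (x - m) ^ 2 * R x := by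
  have hm0 : 0 < m := by linarith
  have hD : ∀ x, lam / 2 < x → 0 < (w₁ x + w₂ x) * (x * m * (x + m + 2 * lam) * (x + m - lam)) +
      lam * (x + m) ^ 2 * (lam * (w₁ x + w₂ x) + w₁ x * m + w₂ x * x) := by
    intro x hx
    have hx0 : 0 < x := by linarith
    have hM : 0 < x + m - lam := by linarith
    have := hw₁ x hx0
    have := hw₂ x hx0
    positivity
  -- `hid` is the expansion multiplied by both denominators, so `R` must be `q` over their product.
  refine ⟨fun x => q x / (4 * m * (m + lam) * (2 * m + lam) *
    ((w₁ x + w₂ x) * (x * m * (x + m + 2 * lam) * (x + m - lam)) +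
      lam * (x + m) ^ 2 * (lam * (w₁ x + w₂ x) + w₁ x * m + w₂ x * x))), ?_, fun x hx => ⟨?_, ?_⟩⟩
  · refine ContinuousAt.div hqc.continuousAt (by fun_prop) ?_
    have := hD m hm
    positivity
  · have := hD x hx
    have := hq x hx
    positivity
  · have hx0 : 0 < x := by linarith
    have hW : 0 < w₁ x + w₂ x := add_pos (hw₁ x hx0) (hw₂ x hx0)
    have hDx := hD x hx
    have hidx := hid x
    have hI : idleFun lam (w₁ x / (w₁ x + w₂ x)) x m = x * (x + m - lam) *
          ((w₁ x + w₂ x) * (m * (x + m) + 2 * lam * m + lam ^ 2) + lam * w₂ x * (x + m)) /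
        ((w₁ x + w₂ x) * (x * m * (x + m + 2 * lam) * (x + m - lam)) +
          lam * (x + m) ^ 2 * (lam * (w₁ x + w₂ x) + w₁ x * m + w₂ x * x)) := by
      have h1 : 1 - w₁ x / (w₁ x + w₂ x) = w₂ x / (w₁ x + w₂ x) := by field_simp; ring
      rw [idleFun, h1, ← mul_div_mul_left _ _ hW.ne']
      congr 1 <;> field_simp
    rw [hp x hx0, hI, marginalIdle]
    beta_reduce
    generalize (w₁ x + w₂ x) * (x * m * (x + m + 2 * lam) * (x + m - lam)) +
      lam * (x + m) ^ 2 * (lam * (w₁ x + w₂ x) + w₁ x * m + w₂ x * x) = D at *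
    generalize x * (x + m - lam) *
      ((w₁ x + w₂ x) * (m * (x + m) + 2 * lam * m + lam ^ 2) + lam * w₂ x * (x + m)) = N at *
    have e : N = (D * (2 * (2 * m - lam) * (m + lam) * (2 * m + lam) +
          lam * ((4 - 2 * r) * m + (4 + r) * lam) * (x - m)) - (x - m) ^ 2 * q x) /
        (4 * m * (m + lam) * (2 * m + lam)) := by
      rw [eq_div_iff (by positivity)]
      linear_combination -hidx
    rw [e]
    field_simp
    ring

/-- Multiplying numerator and denominator of the routing probability by a suitable power turns it
into a ratio of polynomial weights `w₁`, `w₂`; `ring` then verifies the resulting identity. -/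
theorem idleFun_expansion {lam r m : ℝ} (hlam : 0 < lam) (hr : r ∈ ({-2, -1, 0, 1} : Set ℝ))
    (hm : lam / 2 < m) :
    ∃ R : ℝ → ℝ, ContinuousAt R m ∧ ∀ x, lam / 2 < x → 0 ≤ R x ∧
      idleFun lam (x ^ r / (x ^ r + m ^ r)) x m =
        1 - lam / (2 * m) + marginalIdle lam r m * (x - m) - (x - m) ^ 2 * R x := by
  have hm0 : 0 < m := by linarith
  have hh : 0 ≤ lam / 2 := by positivity
  have hb : 0 ≤ m - lam / 2 := by linarith
  rcases hr with rfl | rfl | rfl | rfl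
  · refine idleFun_expansion_of_identity (w₁ := fun _ => m ^ 2) (w₂ := fun x => x ^ 2)
      (q := fun x => remainderNegTwo (lam / 2) (x - lam / 2) (m - lam / 2)) hlam hm
      (fun _ _ => by positivity) (fun x hx => by positivity) (by fun_prop) (by fun_prop)
      (by unfold remainderNegTwo; fun_prop)
      (fun x hx => remainderNegTwo_nonneg hh (by linarith) hb) (fun x hx => ?_) (fun x => ?_)
    · have hx0 : 0 < x := hx
      rw [show (-2 : ℝ) = ((-2 : ℤ) : ℝ) by norm_num, Real.rpow_intCast, Real.rpow_intCast]
      simp only [zpow_neg, zpow_ofNat]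
      field_simp
    · unfold remainderNegTwo; ring
  · refine idleFun_expansion_of_identity (w₁ := fun _ => m) (w₂ := fun x => x)
      (q := fun x => remainderNegOne (lam / 2) (x - lam / 2) (m - lam / 2)) hlam hm
      (fun _ _ => by positivity) (fun x hx => hx) (by fun_prop) (by fun_prop)
      (by unfold remainderNegOne; fun_prop)
      (fun x hx => remainderNegOne_nonneg hh (by linarith) hb) (fun x hx => ?_) (fun x => ?_)
    · have hx0 : 0 < x := hx
      rw [Real.rpow_neg_one, Real.rpow_neg_one]
      field_simp
    · unfold remainderNegOne; ring
  · refine idleFun_expansion_of_identity (w₁ := fun _ => 1) (w₂ := fun _ => 1)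
      (q := fun x => remainderZero (lam / 2) (x - lam / 2) (m - lam / 2)) hlam hm
      (fun _ _ => by positivity) (fun x hx => by positivity) (by fun_prop) (by fun_prop)
      (by unfold remainderZero; fun_prop)
      (fun x hx => remainderZero_nonneg hh (by linarith) hb) (fun x hx => ?_) (fun x => ?_)
    · rw [Real.rpow_zero, Real.rpow_zero]
    · unfold remainderZero; ring
  · refine idleFun_expansion_of_identity (w₁ := fun x => x) (w₂ := fun _ => m)
      (q := fun x => remainderOne (lam / 2) (x - lam / 2) (m - lam / 2)) hlam hm
      (fun _ hx => hx) (fun x hx => by positivity) (by fun_prop) (by fun_prop)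
      (by unfold remainderOne; fun_prop)
      (fun x hx => remainderOne_nonneg hh (by linarith) hb) (fun x hx => ?_) (fun x => ?_)
    · rw [Real.rpow_one, Real.rpow_one]
    · unfold remainderOne; ring

/-! ### The marginal idle probability at equal rates -/

section Marginal

variable {lam r : ℝ}

theorem marginalIdle_half (hlam : 0 < lam) : marginalIdle lam r (lam / 2) = 1 / lam := by
  unfold marginalIdle
  field_simp
  ring

/-- Cancelling `m` in the first summand of the numerator splits the function into two decreasing
terms, with coefficients `4 - 2 * r` and `4 + r`, both positive in this range; `h3` and `h4` are
their cross-multiplied comparisons. -/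
theorem strictAntiOn_marginalIdle (hlam : 0 < lam) (hr : -4 < r) (hr' : r < 2) :
    StrictAntiOn (marginalIdle lam r) (Ioi 0) := by
  intro x (hx : 0 < x) y (hy : 0 < y) hxy
  unfold marginalIdle
  have hs : 0 < 4 - 2 * r := by linarith
  have ht : 0 < 4 + r := by linarith
  have h1 : (x + lam) * (2 * x + lam) < (y + lam) * (2 * y + lam) := by gcongr
  have h2 : x * ((x + lam) * (2 * x + lam)) < y * ((y + lam) * (2 * y + lam)) := by gcongr
  rw [div_lt_div_iff₀ (by positivity) (by positivity)]
  generalize 4 - 2 * r = s at *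
  generalize 4 + r = t at *
  have h3 := mul_lt_mul_of_pos_left h1 (show 0 < 4 * lam * s * x * y by positivity)
  have h4 := mul_lt_mul_of_pos_left h2 (show 0 < 4 * lam * t * lam by positivity)
  linarith

theorem marginalIdle_le (hlam : 0 < lam) (hr : -2 ≤ r) (hr' : r ≤ 1) {m : ℝ} (hm : 0 < m) :
    marginalIdle lam r m ≤ 2 / m := by
  unfold marginalIdle
  rw [div_le_div_iff₀ (by positivity) hm]
  have h1 : (4 - 2 * r) * m + (4 + r) * lam ≤ 8 * (m + lam) := by nlinarith
  have h2 := mul_le_mul_of_nonneg_left h1 (show 0 ≤ lam * m by positivity)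
  have h3 : 0 < m * m * (m + lam) := by positivity
  nlinarith

/-- The numerator is affine in `r` with slope `lam * (lam - 2 * m)`, negative for `m > lam / 2`. -/
theorem marginalIdle_lt_of_lt {r' : ℝ} (hlam : 0 < lam) (hr : r < r') {m : ℝ}
    (hm : lam / 2 < m) : marginalIdle lam r' m < marginalIdle lam r m := by
  have : 0 < m := by linarith
  unfold marginalIdle
  gcongr 1
  apply mul_lt_mul_of_pos_left _ hlam
  nlinarith

theorem continuousOn_marginalIdle (hlam : 0 < lam) :
    ContinuousOn (marginalIdle lam r) (Ioi 0) := by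
  unfold marginalIdle
  refine ContinuousOn.div (by fun_prop) (by fun_prop) fun m (hm : 0 < m) => ?_
  positivity

end Marginal

/-! ### Consequences of convexity of the cost -/

section Cost

variable {c : ℝ → ℝ}

theorem IsEffortCost.differentiableAt_zero (hc : IsEffortCost c) {x : ℝ} (hx : 0 < x) :
    DifferentiableAt ℝ c x := by
  simpa using hc.differentiableAt 0 (by norm_num) x hx

theorem IsEffortCost.continuousOn_deriv (hc : IsEffortCost c) :
    ContinuousOn (deriv c) (Ioi 0) := fun x hx => by
  have := hc.differentiableAt 1 (by norm_num) x hx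
  rw [iteratedDeriv_one] at this
  exact this.continuousAt.continuousWithinAt

theorem IsEffortCost.monotoneOn_deriv (hc : IsEffortCost c) : MonotoneOn (deriv c) (Ioi 0) :=
  hc.convexOn.monotoneOn_deriv fun _ hx => hc.differentiableAt_zero hx

/-- Strict monotonicity alone gives only a nonnegative derivative; by convexity it dominates the
positive slope of the chord from `x / 2` to `x`. -/
theorem IsEffortCost.deriv_pos (hc : IsEffortCost c) {x : ℝ} (hx : 0 < x) : 0 < deriv c x := by
  have hx2 : 0 < x / 2 := by positivity
  have hlt : x / 2 < x := by linarith
  refine lt_of_lt_of_le ?_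
    (hc.convexOn.slope_le_deriv hx2 hx hlt (hc.differentiableAt_zero hx))
  rw [slope_def_field]
  exact div_pos (sub_pos.2 (hc.strictMonoOn hx2 hx hlt)) (sub_pos.2 hlt)

theorem IsEffortCost.tangent_le (hc : IsEffortCost c) {x m : ℝ} (hx : 0 < x) (hm : 0 < m) :
    c m + deriv c m * (x - m) ≤ c x := by
  have hd := hc.differentiableAt_zero hm
  rcases lt_trichotomy x m with h | rfl | h
  · have := hc.convexOn.slope_le_deriv hx hm h hd
    rw [slope_def_field, div_le_iff₀ (by linarith)] at this
    linarith
  · simp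
  · have := hc.convexOn.deriv_le_slope hm hx h hd
    rw [slope_def_field, le_div_iff₀ (by linarith)] at this
    linarith

end Cost

/-! ### Symmetric equilibria: first-order condition, uniqueness, dependence on `r` -/

section Equilibrium

variable {lam r m : ℝ} {c : ℝ → ℝ}

theorem rev_ne_self (i : Fin 2) : Fin.rev i ≠ i := by
  fin_cases i <;> decide

theorem idleProb_update (hlam : 0 < lam) (hm : lam / 2 < m) (i : Fin 2) {x : ℝ}
    (hx : lam / 2 < x) :
    idleProb lam r (Function.update (fun _ => m) i x) i =
      idleFun lam (x ^ r / (x ^ r + m ^ r)) x m := by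
  have hμ : ∀ j, lam / 2 < Function.update (fun _ => m) i x j := by
    intro j
    by_cases h : j = i <;> simp [h, hx, hm]
  rw [idleProb_eq_idleFun hlam hμ]
  have : routingProb r (Function.update (fun _ => m) i x) Finset.univ i =
      x ^ r / (x ^ r + m ^ r) := by
    fin_cases i <;> simp [routingProb, Function.update_apply, add_comm]
  rw [this, Function.update_self, Function.update_of_ne (rev_ne_self i)]

/-- Necessity is Fermat's rule at an interior maximum. Sufficiency is global: the remainder `(x - m)
^ 2 * R x` is nonnegative, and `c` lies above its tangent. -/
theorem isSymmetricEquilibrium_iff (hlam : 0 < lam) (hc : IsEffortCost c)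
    (hr : r ∈ ({-2, -1, 0, 1} : Set ℝ)) :
    IsSymmetricEquilibrium lam r c m ↔ lam / 2 < m ∧ deriv c m = marginalIdle lam r m := by
  rw [IsSymmetricEquilibrium, IsNashEquilibrium, forall_const]
  refine and_congr_right fun hm => ?_
  have hm0 : 0 < m := by linarith
  obtain ⟨R, hRc, hR⟩ := idleFun_expansion hlam hr hm
  have hU : ∀ i x, lam / 2 < x → utility lam r c (Function.update (fun _ => m) i x) i =
      1 - lam / (2 * m) + marginalIdle lam r m * (x - m) - (x - m) ^ 2 * R x - c x := by
    intro i x hx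
    rw [utility, idleProb_update hlam hm i hx, (hR x hx).2, Function.update_self]
  have hU' : ∀ i, utility lam r c (fun _ => m) i = 1 - lam / (2 * m) - c m := by
    intro i
    have := hU i m hm
    rw [Function.update_eq_self] at this
    simpa using this
  constructor
  · intro h
    have hmax : IsLocalMax (fun x => 1 - lam / (2 * m) + marginalIdle lam r m * (x - m)
        - (x - m) ^ 2 * R x - c x) m := by
      filter_upwards [Ioi_mem_nhds hm] with x hx
      have := h 0 x hx
      rw [hU 0 x hx, hU' 0] at this
      simpa using this
    -- `R` is only known to be continuous at `m`; this suffices, since the difference quotient is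
    -- `(x - m) * R x`.
    have hd : HasDerivAt (fun x => (x - m) ^ 2 * R x) 0 m := by
      rw [hasDerivAt_iff_tendsto_slope]
      have ht : Filter.Tendsto (fun x => (x - m) * R x) (nhdsWithin m {m}ᶜ) (nhds 0) := by
        have : ContinuousAt (fun x => (x - m) * R x) m := by fun_prop
        simpa using this.tendsto.mono_left nhdsWithin_le_nhds
      refine ht.congr' ?_
      filter_upwards [self_mem_nhdsWithin] with x hx
      have : x - m ≠ 0 := sub_ne_zero.2 hx
      rw [slope_def_field]
      field_simp
      simp
    have hlin : HasDerivAt (fun x => 1 - lam / (2 * m) + marginalIdle lam r m * (x - m))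
        (marginalIdle lam r m) m := by
      simpa using (((hasDerivAt_id m).sub_const m).const_mul
        (marginalIdle lam r m)).const_add (1 - lam / (2 * m))
    have := hmax.hasDerivAt_eq_zero
      ((hlin.sub hd).sub (hc.differentiableAt_zero hm0).hasDerivAt)
    linarith
  · intro h i x hx
    have h1 := hc.tangent_le (show 0 < x by linarith) hm0
    have h2 := mul_nonneg (sq_nonneg (x - m)) (hR x hx).1
    rw [hU i x hx, hU' i, ← h]
    linarith

theorem existsUnique_isSymmetricEquilibrium (hlam : 0 < lam) (hc : IsEffortCost c)
    (hc' : deriv c (lam / 2) < 1 / lam) (hr : r ∈ ({-2, -1, 0, 1} : Set ℝ)) :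
    ∃! m, IsSymmetricEquilibrium lam r c m := by
  have hr2 : -2 ≤ r ∧ r ≤ 1 := by
    rcases hr with rfl | rfl | rfl | rfl <;> norm_num
  have hanti := strictAntiOn_marginalIdle (r := r) hlam (by linarith) (by linarith)
  have hh : 0 < lam / 2 := by positivity
  simp only [isSymmetricEquilibrium_iff hlam hc hr]
  refine existsUnique_of_exists_of_unique ?_ ?_
  · have hpos := hc.deriv_pos hh
    have hK : lam / 2 < lam / 2 + 2 / deriv c (lam / 2) := by
      have : 0 < 2 / deriv c (lam / 2) := by positivity
      linarith
    -- Chosen so that `2 / K < deriv c (lam / 2)`: at `K` the bound `2 / m` on the marginal idle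
    -- probability is already below the marginal cost.
    set K := lam / 2 + 2 / deriv c (lam / 2)
    have hK0 : 0 < K := hh.trans hK
    have hcont : ContinuousOn (fun m => deriv c m - marginalIdle lam r m) (Icc (lam / 2) K) :=
      (hc.continuousOn_deriv.sub (continuousOn_marginalIdle hlam)).mono
        fun x hx => hh.trans_le hx.1
    obtain ⟨m, hm, hm0⟩ := intermediate_value_Ioo hK.le hcont (show (0 : ℝ) ∈ Ioo _ _ from by
      constructor
      · simp only [marginalIdle_half hlam]
        linarith
      · have h1 := marginalIdle_le hlam hr2.1 hr2.2 hK0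
        have h2 := hc.monotoneOn_deriv hh hK0 hK.le
        have h3 : 2 / K < deriv c (lam / 2) := by
          rw [div_lt_iff₀ hK0, mul_add, mul_div_cancel₀ _ hpos.ne']
          linarith [mul_pos hpos hh]
        linarith)
    exact ⟨m, hm.1, sub_eq_zero.1 hm0⟩
  · have key : ∀ m m', lam / 2 < m → m < m' → deriv c m = marginalIdle lam r m →
        deriv c m' = marginalIdle lam r m' → False := by
      intro m m' hm hlt h h'
      have hm0 : 0 < m := hh.trans hm
      have h1 := hc.monotoneOn_deriv hm0 (hm0.trans hlt) hlt.le
      have h2 := hanti hm0 (hm0.trans hlt) hlt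
      linarith
    rintro m m' ⟨hm, h⟩ ⟨hm', h'⟩
    rcases lt_trichotomy m m' with hlt | heq | hlt
    · exact (key m m' hm hlt h h').elim
    · exact heq
    · exact (key m' m hm' hlt h' h).elim

/-- If `m ≤ m'`, then `deriv c m ≤ deriv c m' = marginalIdle lam r' m' < marginalIdle lam r m' ≤
marginalIdle lam r m`, contradicting the first-order condition at `m`. -/
theorem IsSymmetricEquilibrium.lt_of_lt {r' m' : ℝ} (hlam : 0 < lam) (hc : IsEffortCost c)
    (hr : r ∈ ({-2, -1, 0, 1} : Set ℝ)) (hr' : r' ∈ ({-2, -1, 0, 1} : Set ℝ)) (hrr : r < r')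
    (hm : IsSymmetricEquilibrium lam r c m) (hm' : IsSymmetricEquilibrium lam r' c m') :
    m' < m := by
  rw [isSymmetricEquilibrium_iff hlam hc hr] at hm
  rw [isSymmetricEquilibrium_iff hlam hc hr'] at hm'
  have hr2 : -2 ≤ r ∧ r ≤ 1 := by
    rcases hr with rfl | rfl | rfl | rfl <;> norm_num
  by_contra! hle
  have hm0 : 0 < m := by linarith [hm.1]
  have hm0' : 0 < m' := by linarith
  have h1 := hc.monotoneOn_deriv hm0 hm0' hle
  have h2 := (strictAntiOn_marginalIdle (r := r) hlam (by linarith) (by linarith)).antitoneOn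
    hm0 hm0' hle
  have h3 := marginalIdle_lt_of_lt hlam hrr hm'.1
  linarith [hm.2, hm'.2]

end Equilibrium

/-! ### Mean response time at equal rates -/

section ResponseTime

variable {lam r m : ℝ}

/-- Equal rates make every routing probability `1 / 2`, so `r` drops out and the classical M/M/2
queue remains. -/
theorem hasMeanResponseTime_symmetric (hlam : 0 < lam) (hm : lam / 2 < m) :
    HasMeanResponseTime lam r (fun _ => m) (4 * m / (4 * m ^ 2 - lam ^ 2)) := by
  have hm0 : 0 < m := by linarith
  have hrp : ∀ i, routingProb r (fun _ : Fin 2 => m) Finset.univ i = 1 / 2 := by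
    intro i
    have := Real.rpow_pos_of_pos hm0 r
    simp only [routingProb, Fin.sum_univ_two]
    field_simp
    norm_num
  have hs : ∀ i, weight lam (routingProb r (fun _ : Fin 2 => m) Finset.univ) (fun _ => m)
      (.single i) = lam / (2 * m) := by
    intro i
    simp only [weight, hrp]
    field_simp
    ring
  have hlt : lam / (m + m) < 1 := (div_lt_one (by positivity)).2 (by linarith)
  have hnorm : ‖lam / (m + m)‖ < 1 := by
    rwa [Real.norm_of_nonneg (by positivity)]
  have hd : 2 * m - lam ≠ 0 := by linarith
  have hZ : totalWeight lam (routingProb r (fun _ : Fin 2 => m) Finset.univ) (fun _ => m) =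
      (2 * m + lam) / (2 * m - lam) := by
    simp only [totalWeight, hs]
    rw [← two_mul m]
    field_simp
    ring
  have h1 : 1 - lam / (m + m) = (2 * m - lam) / (2 * m) := by
    rw [← two_mul m]; field_simp
  -- With `k` customers waiting the mean response is `(k + 1) / (2 * m) + 1 / m = k / (2 * m) + 3 /
  -- (2 * m)`, whence the two series.
  have hb := ((hasSum_coe_mul_geometric_of_norm_lt_one hnorm).mul_left
      (lam ^ 2 / (2 * m ^ 2) * ((2 * m - lam) / (2 * m + lam)) / (2 * m))).add
    ((hasSum_geometric_of_lt_one (by positivity) hlt).mul_left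
      (lam ^ 2 / (2 * m ^ 2) * ((2 * m - lam) / (2 * m + lam)) * (3 / (2 * m))))
  have hbusy := hb.congr_fun (g := fun k : ℕ => steadyState lam r (fun _ => m) (.busy k) *
      meanResponseFrom r (fun _ => m) (.busy k)) ?_
  · rw [HasMeanResponseTime]
    convert hasSum_state (f := fun s => steadyState lam r (fun _ => m) s *
      meanResponseFrom r (fun _ => m) s) hbusy using 1
    rw [steadyState_eq hlam (fun _ => hm)]
    simp only [hZ, h1, meanResponseFrom, hrp, Fin.sum_univ_two, weight]
    have hd2 : 4 * m ^ 2 - lam ^ 2 ≠ 0 := by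
      have : 0 < (2 * m - lam) * (2 * m + lam) := mul_pos (by linarith) (by linarith)
      nlinarith
    rw [show 4 * m ^ 2 - lam ^ 2 = (2 * m - lam) * (2 * m + lam) by ring] at *
    field_simp
    ring
  · intro k
    rw [steadyState_eq hlam (fun _ => hm)]
    simp only [weight_busy, hs, hZ, meanResponseFrom, Fin.sum_univ_two]
    generalize (lam / (m + m)) ^ k = z
    rw [← two_mul m]
    field_simp
    ring

theorem meanResponseTime_strictAntiOn (hlam : 0 < lam) :
    StrictAntiOn (fun m => 4 * m / (4 * m ^ 2 - lam ^ 2)) (Ioi (lam / 2)) := by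
  have hpos : ∀ m, lam / 2 < m → 0 < 4 * m ^ 2 - lam ^ 2 := by
    intro m hm
    have : 0 < (2 * m - lam) * (2 * m + lam) := mul_pos (by linarith) (by linarith)
    linarith
  intro x (hx : lam / 2 < x) y (hy : lam / 2 < y) hxy
  have hx0 : 0 < x := by linarith
  have hy0 : 0 < y := by linarith
  simp only
  rw [div_lt_div_iff₀ (hpos y hy) (hpos x hx)]
  have : 0 < (y - x) * (16 * x * y + 4 * lam ^ 2) := mul_pos (by linarith) (by positivity)
  linarith

end ResponseTime

end MM2

theorem theorem13 (lam : ℝ) (hlam : 0 < lam) (c : ℝ → ℝ) (hc : MM2.IsEffortCost c)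
    (hc' : deriv c (lam / 2) < 1 / lam) :
    (∀ (r : ℝ) (μ : Fin 2 → ℝ), (∀ i, lam / 2 < μ i) → ∃! π, MM2.IsSteadyState lam r μ π) ∧
    (∀ r ∈ ({-2, -1, 0, 1} : Set ℝ), ∃! m, MM2.IsSymmetricEquilibrium lam r c m) ∧
    (∀ m₂ m₀ : ℝ, MM2.IsSymmetricEquilibrium lam (-2) c m₂ →
      MM2.IsSymmetricEquilibrium lam 0 c m₀ →
      ∃ T₂ T₀ : ℝ, MM2.HasMeanResponseTime lam (-2) (fun _ => m₂) T₂ ∧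
        MM2.HasMeanResponseTime lam 0 (fun _ => m₀) T₀ ∧ T₂ < T₀) := by
  refine ⟨fun r μ hμ => MM2.existsUnique_isSteadyState hlam hμ,
    fun r hr => MM2.existsUnique_isSymmetricEquilibrium hlam hc hc' hr, fun m₂ m₀ h₂ h₀ => ?_⟩
  have hlt : m₀ < m₂ := h₂.lt_of_lt hlam hc (by simp) (by simp) (by norm_num) h₀
  have hm₂ : lam / 2 < m₂ := h₂.1 0
  have hm₀ : lam / 2 < m₀ := h₀.1 0
  exact ⟨_, _, MM2.hasMeanResponseTime_symmetric hlam hm₂,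
    MM2.hasMeanResponseTime_symmetric hlam hm₀,
    MM2.meanResponseTime_strictAntiOn hlam hm₀ hm₂ hlt⟩
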